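/- Let $n,m_1,m_2\ge 1$ be integers with $m_1,m_2$ coprime, and put $d=\frac{m_1-m_2}{m_1+m_2}$, $M=(n+1)(m_1+m_2)$, $D_0=(x,(n+1)y)^T$ and $I_M=(y-x^{n+1})^{m_1}(y+x^{n+1})^{m_2}$. Let $\mathscr P_k$ be the space of real polynomials in $x,y$ that are quasi-homogeneous of degree $k$ for the weights $\mathbf t=(1,n+1)$, and call a vector field quasi-homogeneous of degree $k$ if its two components lie in $\mathscr P_{k+1}$ and $\mathscr P_{k+n+1}$. Let $F=\sum_{j\ge n}F_j$ be a (formal) planar vector field with real coefficients, where $F_j$ is a quasi-homogeneous polynomial vector field of degree $j$ and $$F_n=\begin{pmatrix} y+d\,x^{n+1}\\ (n+1)x^{2n+1}+(n+1)d\,x^n y\end{pmatrix}.$$ For $j\ge n$ let $\ell_j:\mathscr P_{j-n}\to\mathscr P_j$, $\ell_j(p)=\nabla p\cdot F_n$, and, for $n\le j\le M+n-1$, let $\mathrm{Cor}(\ell_j)$ be any subspace of $\mathscr P_j$ complementary to the range of $\ell_j$. Then there are polynomials $\eta_j^{(i)}\in\mathrm{Cor}(\ell_j)$ (for $i\ge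 0$, $n\le j\le M+n-1$) such that $F$ is formally orbitally equivalent to $$F_n+\sum_{j=n+1}^{M+n-1}\eta_j^{(0)}D_0+\sum_{i=1}^{\infty}\sum_{j=n}^{M+n-1}\eta_j^{(i)}I_M^{\,i}D_0 .$$ Here $F$ is formally orbitally equivalent to $G$ if there are a formal map $\Phi=(\Phi_1,\Phi_2)$ with $\Phi(0)=0$, $\det D\Phi(0)\ne 0$, and a formal power series $\nu$ with $\nu(0)>0$, such that $D\Phi\cdot(\nu F)=G\circ\Phi$. -/

import Mathlib

open scoped MvPowerSeries.WithPiTopology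

noncomputable section

namespace QHNormalForm

/-- Real polynomials in `x = X 0` and `y = X 1`. -/
abbrev Poly := MvPolynomial (Fin 2) ℝ

/-- Real formal power series in `x` and `y`. -/
abbrev Ser := MvPowerSeries (Fin 2) ℝ

/-- Polynomial vector fields on the plane. -/
abbrev PolyField := Fin 2 → Poly

/-- Formal vector fields on the plane. -/
abbrev FormalField := Fin 2 → Ser

/-- A polynomial vector field seen as a formal vector field. -/
def toFormal (V : PolyField) : FormalField := fun i => (V i : Ser)

/-- The type `t = (1, n + 1)`: the weights of `x` and `y`. -/
def wt (n : ℕ) : Fin 2 → ℕ := ![1, n + 1]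

/-- The space of quasi-homogeneous polynomials of type `(1, n + 1)` and degree `k`. -/
def qhPoly (n k : ℕ) : Submodule ℝ Poly :=
  MvPolynomial.weightedHomogeneousSubmodule ℝ (wt n) k

/-- `V` is a quasi-homogeneous vector field of type `t = (1, n + 1)` and degree `k`: its `i`-th
component is quasi-homogeneous of degree `k + t i`. -/
def IsQHField (n k : ℕ) (V : PolyField) : Prop :=
  ∀ i, V i ∈ qhPoly n (k + wt n i)

/-- The field `D₀ = (x, (n + 1) y)`. -/
def eulerField (n : ℕ) : PolyField :=
  ![MvPolynomial.X 0, MvPolynomial.C ((n : ℝ) + 1) * MvPolynomial.X 1]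

/-- The field `(y + d x ^ (n + 1), (n + 1) x ^ (2 n + 1) + (n + 1) d x ^ n y)`. -/
def leadingField (n : ℕ) (d : ℝ) : PolyField :=
  ![MvPolynomial.X 1 + MvPolynomial.C d * MvPolynomial.X 0 ^ (n + 1),
    MvPolynomial.C ((n : ℝ) + 1) * MvPolynomial.X 0 ^ (2 * n + 1)
      + MvPolynomial.C (((n : ℝ) + 1) * d) * (MvPolynomial.X 0 ^ n * MvPolynomial.X 1)]

/-- The number `d = (m₁ - m₂) / (m₁ + m₂)`. -/
def dissipation (m₁ m₂ : ℕ) : ℝ := ((m₁ : ℝ) - m₂) / ((m₁ : ℝ) + m₂)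

/-- The polynomial `I_M = (y - x ^ (n + 1)) ^ m₁ * (y + x ^ (n + 1)) ^ m₂`. -/
def firstIntegral (n m₁ m₂ : ℕ) : Poly :=
  (MvPolynomial.X 1 - MvPolynomial.X 0 ^ (n + 1)) ^ m₁
    * (MvPolynomial.X 1 + MvPolynomial.X 0 ^ (n + 1)) ^ m₂

/-- The quasi-homogeneous degree `M = (n + 1) (m₁ + m₂)` of `I_M`. -/
def integralDegree (n m₁ m₂ : ℕ) : ℕ := (n + 1) * (m₁ + m₂)

/-- The derivation `p ↦ ∇p · V`. -/
def lieDeriv (V : PolyField) : Poly →ₗ[ℝ] Poly :=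
  ∑ i, LinearMap.mulLeft ℝ (V i) ∘ₗ (MvPolynomial.pderiv i).toLinearMap

/-- For `n ≤ j`, the range of the operator `ℓ_j : p ↦ ∇p · Fₙ` from the quasi-homogeneous
polynomials of degree `j - n` to those of degree `j`, where `Fₙ = leadingField n d`. -/
def rangeEll (n : ℕ) (d : ℝ) (j : ℕ) : Submodule ℝ Poly :=
  (qhPoly n (j - n)).map (lieDeriv (leadingField n d))

/-- For `n ≤ j`, `C` is a complementary subspace to the range of `ℓ_j` in the space of
quasi-homogeneous polynomials of degree `j`. -/
def IsCorange (n : ℕ) (d : ℝ) (j : ℕ) (C : Submodule ℝ Poly) : Prop :=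
  Disjoint C (rangeEll n d j) ∧ C ⊔ rangeEll n d j = qhPoly n j

/-- `Φ` is a formal diffeomorphism that fixes the origin. -/
def IsFormalDiffeo (Φ : Fin 2 → Ser) : Prop :=
  (∀ i, MvPowerSeries.constantCoeff (Φ i) = 0) ∧
    (Matrix.of fun i j : Fin 2 =>
      MvPowerSeries.constantCoeff (MvPowerSeries.pderiv ℝ j (Φ i))).det ≠ 0

/-- Formal orbital equivalence: after multiplication by a formal function `ν` with `ν(0) > 0`
(a change of time), `F` is carried to `G` by a formal diffeomorphism `Φ` that fixes the origin,
that is, `DΦ (ν F) = G ∘ Φ`. -/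
def FormallyOrbitallyEquivalent (F G : FormalField) : Prop :=
  ∃ (Φ : Fin 2 → Ser) (ν : Ser), IsFormalDiffeo Φ ∧ 0 < MvPowerSeries.constantCoeff ν ∧
    ∀ i, ∑ j, MvPowerSeries.pderiv ℝ j (Φ i) * (ν * F j) = MvPowerSeries.subst Φ (G i)

end QHNormalForm

end

/-! The normal form is built degree by degree. Suppose `(Φ, ν)` conjugates `F` to `G` with a defect
starting in degree `s + n`. Replacing `Φ` by `Φ - U`, `ν` by `ν - α` and `G` by `G + θ D₀`, with `U`
and `α` of degree `s`, changes the lowest part of the defect by `-(α Fₙ + θ D₀ + [Fₙ, U])`, where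
`[F, U] = DU · F - DF · U`. So each step asks for every field of degree `s + n` to have this form
with `θ` in a prescribed space (`exists_homological`).

Modulo multiples of `Fₙ` and `D₀`, such a field is a pair of pure powers of `x`
(`IsQHField.reducesToMonomials`). Brackets with pure powers of `x` remove this pair by a 2 × 2
linear system with determinant `s² d² - (s + 2n + 2)²`, nonzero because `|d| ≤ 1`. A multiple `β D₀`
is left. Since `[Fₙ, D₀] = -n Fₙ`, the field `ℓ(p) D₀` is a bracket plus a multiple of `Fₙ`, so `β`
matters only modulo the range of `ℓ`.

It remains to see that `I_M ^ i Cor(ℓ_j)` spans degree `j + i M` modulo the range. As `ℓ(I_M) = 0`,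
induction on `i` reduces this to showing that each polynomial of degree `j + M` is a multiple of
`I_M` modulo the range; the factors of `I_M` are split off one by one
(`exists_eq_lieDeriv_add_pow_mul`).

The successive corrections have increasing weight, so `Φ`, `ν` and `G` converge, and the limit has
no defect. -/

noncomputable section

namespace QHNormalForm

/-! ### Quasi-homogeneous polynomials -/

section Quasihomogeneous

open MvPolynomial

variable {n : ℕ}

lemma X_zero_mem_qhPoly : (X 0 : Poly) ∈ qhPoly n 1 := isWeightedHomogeneous_X ℝ (wt n) 0

lemma X_one_mem_qhPoly : (X 1 : Poly) ∈ qhPoly n (n + 1) := isWeightedHomogeneous_X ℝ (wt n) 1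

lemma mul_mem_qhPoly {p q : Poly} {k l : ℕ} (hp : p ∈ qhPoly n k) (hq : q ∈ qhPoly n l) :
    p * q ∈ qhPoly n (k + l) := IsWeightedHomogeneous.mul hp hq

lemma pow_mem_qhPoly {p : Poly} {k : ℕ} (hp : p ∈ qhPoly n k) (a : ℕ) :
    p ^ a ∈ qhPoly n (a * k) := by
  have h := IsWeightedHomogeneous.pow hp a
  rwa [smul_eq_mul] at h

lemma C_mul_mem_qhPoly {p : Poly} {k : ℕ} (c : ℝ) (hp : p ∈ qhPoly n k) :
    C c * p ∈ qhPoly n k := IsWeightedHomogeneous.C_mul hp c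

lemma X_zero_pow_mem_qhPoly (a : ℕ) : (X 0 ^ a : Poly) ∈ qhPoly n a := by
  simpa using pow_mem_qhPoly (X_zero_mem_qhPoly (n := n)) a

lemma X_pow_mul_X_pow_mem_qhPoly {a b k : ℕ} (h : a + (n + 1) * b = k) :
    (X 0 ^ a * X 1 ^ b : Poly) ∈ qhPoly n k := by
  have := mul_mem_qhPoly (X_zero_pow_mem_qhPoly (n := n) a)
    (pow_mem_qhPoly (X_one_mem_qhPoly (n := n)) b)
  rwa [mul_comm b, h] at this

lemma weight_wt (n : ℕ) (e : Fin 2 →₀ ℕ) :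
    Finsupp.weight (wt n) e = e 0 + (n + 1) * e 1 := by
  simp [Finsupp.weight_eq_sum, wt, mul_comm]

lemma qhPoly_induction {k : ℕ} {P : Poly → Prop} (zero : P 0)
    (add : ∀ p q, P p → P q → P (p + q))
    (mon : ∀ (c : ℝ) (a b : ℕ), a + (n + 1) * b = k → P (C c * (X 0 ^ a * X 1 ^ b)))
    {p : Poly} (hp : p ∈ qhPoly n k) : P p := by
  rw [p.as_sum]
  refine Finset.sum_induction _ P add zero fun e he => ?_
  have h := hp (mem_support_iff.1 he)
  rw [weight_wt] at h
  rw [monomial_eq]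
  simpa [Finsupp.prod_fintype] using mon (coeff e p) (e 0) (e 1) h

/-- Division by `y - r x ^ (n + 1)`: by homogeneity the remainder, which is the restriction to the
branch, is a single power of `x`. -/
lemma exists_eq_pow_add_mul (r : ℝ) {k : ℕ} {p : Poly} (hp : p ∈ qhPoly n (k + (n + 1))) :
    ∃ c : ℝ, ∃ q ∈ qhPoly n k,
      p = C c * X 0 ^ (k + (n + 1)) + (X 1 - C r * X 0 ^ (n + 1)) * q := by
  refine qhPoly_induction (P := fun p => ∃ c : ℝ, ∃ q ∈ qhPoly n k,
      p = C c * X 0 ^ (k + (n + 1)) + (X 1 - C r * X 0 ^ (n + 1)) * q) ?_ ?_ ?_ hp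
  · exact ⟨0, 0, zero_mem _, by simp⟩
  · rintro p q ⟨c, u, hu, rfl⟩ ⟨c', u', hu', rfl⟩
    exact ⟨c + c', u + u', add_mem hu hu', by rw [C_add]; ring⟩
  · intro c a b
    induction b generalizing a c with
    | zero =>
      intro h
      exact ⟨c, 0, zero_mem _, by simp [← h]⟩
    | succ b ih =>
      intro h
      obtain ⟨c', u, hu, h'⟩ := ih (c * r) (a + (n + 1)) (by rw [← h]; ring)
      refine ⟨c', u + C c * (X 0 ^ a * X 1 ^ b), add_mem hu (C_mul_mem_qhPoly _
        (X_pow_mul_X_pow_mem_qhPoly (by rw [mul_add] at h; omega))), ?_⟩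
      have : (C c * (X 0 ^ a * X 1 ^ (b + 1)) : Poly) = C (c * r) * (X 0 ^ (a + (n + 1)) * X 1 ^ b)
        + (X 1 - C r * X 0 ^ (n + 1)) * (C c * (X 0 ^ a * X 1 ^ b)) := by
        rw [C_mul]; ring
      linear_combination this + h'

end Quasihomogeneous

/-! ### The operator `ℓ`: invariant curves, first integral and corange -/

section LieDerivative

open MvPolynomial

lemma lieDeriv_apply (V : PolyField) (p : Poly) :
    lieDeriv V p = V 0 * pderiv 0 p + V 1 * pderiv 1 p := by
  simp [lieDeriv, Fin.sum_univ_two]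

lemma lieDeriv_mul (V : PolyField) (p q : Poly) :
    lieDeriv V (p * q) = lieDeriv V p * q + p * lieDeriv V q := by
  simp only [lieDeriv_apply, pderiv_mul]; ring

lemma lieDeriv_C_mul (V : PolyField) (c : ℝ) (q : Poly) :
    lieDeriv V (C c * q) = C c * lieDeriv V q := by
  rw [C_mul', map_smul, C_mul']

lemma lieDeriv_one (V : PolyField) : lieDeriv V 1 = 0 := by
  simp [lieDeriv_apply]

lemma lieDeriv_pow_of_eq_mul {V : PolyField} {p K : Poly} (h : lieDeriv V p = K * p) (a : ℕ) :
    lieDeriv V (p ^ a) = C (a : ℝ) * K * p ^ a := by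
  induction a with
  | zero => simp [lieDeriv_one]
  | succ a ih =>
    rw [pow_succ, lieDeriv_mul, ih, h]; push_cast; rw [C_add, C_1]; ring

variable {n : ℕ} {d : ℝ}

lemma lieDeriv_leadingField_X_zero_pow (l : ℕ) :
    lieDeriv (leadingField n d) (X 0 ^ (l + 1))
      = C ((l : ℝ) + 1) * (X 0 ^ l * X 1 + C d * X 0 ^ (l + n + 1)) := by
  simp [lieDeriv_apply, leadingField, pderiv_X]; ring

/-- The curve `y = r x ^ (n + 1)`, with `r = ± 1`, is invariant. -/
lemma lieDeriv_leadingField_curve {r : ℝ} (hr : r * r = 1) :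
    lieDeriv (leadingField n d) (X 1 - C r * X 0 ^ (n + 1))
      = C (((n : ℝ) + 1) * (d - r)) * X 0 ^ n * (X 1 - C r * X 0 ^ (n + 1)) := by
  have h : (C r * C r : Poly) = 1 := by rw [← C_mul, hr, C_1]
  simp [lieDeriv_apply, leadingField, pderiv_X]
  linear_combination (-((n : Poly) + 1) * X 0 ^ (2 * n + 1)) * h

/-- If `P` is a Darboux polynomial, the restriction of `q` to the branch `y = r x ^ (n + 1)` can be
removed from `P * q` modulo the range of the derivation. -/
lemma exists_mul_eq_lieDeriv_add_mul {r κ : ℝ} {l : ℕ} {P q : Poly}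
    (hP : lieDeriv (leadingField n d) P = C κ * X 0 ^ n * P)
    (hl : ((l : ℝ) + 1) * (r + d) + κ ≠ 0) (hq : q ∈ qhPoly n (l + (n + 1))) :
    ∃ c : ℝ, ∃ q' ∈ qhPoly n l,
      P * q = lieDeriv (leadingField n d) (P * (C c * X 0 ^ (l + 1)))
        + P * (X 1 - C r * X 0 ^ (n + 1)) * q' := by
  obtain ⟨c, u, hu, rfl⟩ := exists_eq_pow_add_mul r hq
  -- On the branch `y = r x ^ (n + 1)`, the derivative of `P x ^ (l + 1)` is `P` times `((l + 1) (r
  -- + d) + κ) x ^ (l + n + 1)`; `t` matches this with the remainder `c x ^ (l + n + 1)`.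
  set t := c / (((l : ℝ) + 1) * (r + d) + κ) with ht
  have h : C c = C t * ((C (l : ℝ) + 1) * (C r + C d) + C κ : Poly) := by
    rw [← C_1, ← C_add, ← C_add, ← C_mul, ← C_add, ← C_mul, ht, div_mul_cancel₀ _ hl]
  refine ⟨t, u - C (t * (l + 1)) * X 0 ^ l,
    sub_mem hu (C_mul_mem_qhPoly _ (X_zero_pow_mem_qhPoly _)), ?_⟩
  rw [lieDeriv_mul, lieDeriv_C_mul, hP, lieDeriv_leadingField_X_zero_pow, h]
  simp only [C_mul, C_add, C_1]
  ring

/-- Each factor `y ∓ x ^ (n + 1)` is split off by clearing the restriction to its branch. The only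
obstruction is the vanishing of one constant, and the bound on `k` excludes this as long as fewer
than `m₁`, respectively `m₂`, copies of the factor have been split off. -/
lemma exists_eq_lieDeriv_add_pow_mul {m₁ m₂ k : ℕ} (hm₁ : 1 ≤ m₁) (hm₂ : 1 ≤ m₂)
    (hk : (n + 1) * (m₁ + m₂) ≤ k) {q : Poly} (hq : q ∈ qhPoly n (k + n)) (a b : ℕ)
    (ha : a ≤ m₁) (hb : b ≤ m₂) :
    ∃ p ∈ qhPoly n k, ∃ q' ∈ qhPoly n (k + n - (n + 1) * (a + b)),
      q = lieDeriv (leadingField n (dissipation m₁ m₂)) p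
        + (X 1 - C 1 * X 0 ^ (n + 1)) ^ a * (X 1 - C (-1) * X 0 ^ (n + 1)) ^ b * q' := by
  have hcurve : ∀ r : ℝ, (X 1 - C r * X 0 ^ (n + 1) : Poly) ∈ qhPoly n (n + 1) := fun r =>
    sub_mem X_one_mem_qhPoly (C_mul_mem_qhPoly _ (X_zero_pow_mem_qhPoly _))
  set d := dissipation m₁ m₂ with hd
  have hm₁' : (1 : ℝ) ≤ m₁ := by exact_mod_cast hm₁
  have hm₂' : (1 : ℝ) ≤ m₂ := by exact_mod_cast hm₂
  have hd' : d * ((m₁ : ℝ) + m₂) = m₁ - m₂ := by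
    rw [hd, dissipation, div_mul_cancel₀]; positivity
  have hk' : ((n : ℝ) + 1) * (m₁ + m₂) ≤ k := by exact_mod_cast hk
  have hP : ∀ a b : ℕ, lieDeriv (leadingField n d)
      ((X 1 - C 1 * X 0 ^ (n + 1)) ^ a * (X 1 - C (-1) * X 0 ^ (n + 1)) ^ b)
      = C (((n : ℝ) + 1) * (a * (d - 1) + b * (d + 1))) * X 0 ^ n
        * ((X 1 - C 1 * X 0 ^ (n + 1)) ^ a * (X 1 - C (-1) * X 0 ^ (n + 1)) ^ b) := by
    intro a b
    rw [lieDeriv_mul, lieDeriv_pow_of_eq_mul (lieDeriv_leadingField_curve (by norm_num)),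
      lieDeriv_pow_of_eq_mul (lieDeriv_leadingField_curve (by norm_num))]
    simp only [C_mul, C_add, C_sub, C_neg]
    ring
  -- One more factor. The displayed constant is `(l + 1) (r + d) + κ` rewritten with `k = l + 1 + (n
  -- + 1) (a + b)`. For `r = 1` the term in `b` drops out, and for `r = -1` the term in `a`.
  have key : ∀ (a b : ℕ) (r : ℝ), a + b < m₁ + m₂ →
      (k * (r + d) + ((n : ℝ) + 1) * (a * (-1 - r) + b * (1 - r)) ≠ 0) →
      (∃ p ∈ qhPoly n k, ∃ q' ∈ qhPoly n (k + n - (n + 1) * (a + b)),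
        q = lieDeriv (leadingField n d) p
          + (X 1 - C 1 * X 0 ^ (n + 1)) ^ a * (X 1 - C (-1) * X 0 ^ (n + 1)) ^ b * q') →
      ∃ p ∈ qhPoly n k, ∃ q' ∈ qhPoly n (k + n - (n + 1) * (a + b + 1)),
        q = lieDeriv (leadingField n d) p
          + (X 1 - C 1 * X 0 ^ (n + 1)) ^ a * (X 1 - C (-1) * X 0 ^ (n + 1)) ^ b
            * (X 1 - C r * X 0 ^ (n + 1)) * q' := by
    rintro a b r hab hne ⟨p, hp, q', hq', h⟩
    obtain ⟨l, hl⟩ : ∃ l, k = l + 1 + (n + 1) * (a + b) := by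
      have : (n + 1) * (a + b + 1) ≤ (n + 1) * (m₁ + m₂) := Nat.mul_le_mul_left _ hab
      exact ⟨k - (n + 1) * (a + b) - 1, by rw [mul_add _ _ 1] at this; omega⟩
    have e₁ : k + n - (n + 1) * (a + b) = l + (n + 1) := by omega
    have e₂ : k + n - (n + 1) * (a + b + 1) = l := by rw [mul_add _ _ 1]; omega
    rw [e₁] at hq'
    have hlr : (k : ℝ) = l + 1 + (n + 1) * (a + b) := by exact_mod_cast hl
    obtain ⟨c, u, hu, hu'⟩ := exists_mul_eq_lieDeriv_add_mul (r := r) (hP a b)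
      (by rw [hlr] at hne; convert hne using 1; ring) hq'
    refine ⟨p + _, add_mem hp ?_, u, e₂ ▸ hu, by rw [map_add, h, hu', add_assoc]⟩
    have := mul_mem_qhPoly (mul_mem_qhPoly (pow_mem_qhPoly (hcurve 1) a)
      (pow_mem_qhPoly (hcurve (-1)) b))
      (C_mul_mem_qhPoly c (X_zero_pow_mem_qhPoly (n := n) (l + 1)))
    rwa [show a * (n + 1) + b * (n + 1) + (l + 1) = k by rw [hl]; ring] at this
  have h₁ : (1 : ℝ) + d = 2 * m₁ / (m₁ + m₂) := by
    rw [eq_div_iff (by positivity)]; linear_combination hd'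
  have h₂ : (-1 : ℝ) + d = - (2 * m₂ / (m₁ + m₂)) := by
    rw [← neg_div, eq_div_iff (by positivity)]; linear_combination hd'
  have hn : (0 : ℝ) < (n : ℝ) + 1 := by positivity
  -- With `m = m₁` this makes the constant positive for `r = 1` and `a < m₁`; with `m = m₂` it makes
  -- it negative for `r = -1` and `b < m₂`.
  have hbound : ∀ m : ℝ, 0 ≤ m → ((n : ℝ) + 1) * (2 * m) ≤ k * (2 * m / (m₁ + m₂)) := by
    intro m hm
    rw [mul_div_assoc', le_div_iff₀ (by positivity)]
    nlinarith
  induction b with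
  | zero =>
    induction a with
    | zero => exact ⟨0, zero_mem _, q, hq, by simp⟩
    | succ a ih =>
      have hlt : (a : ℝ) < m₁ := by exact_mod_cast ha
      obtain ⟨p, hp, q', hq', h⟩ := key a 0 1 (by omega) (by
        rw [h₁]; have := hbound m₁ (by positivity); nlinarith) (ih (by omega))
      exact ⟨p, hp, q', by convert hq' using 2, by rw [h]; ring⟩
  | succ b ih =>
    have hlt : (b : ℝ) < m₂ := by exact_mod_cast hb
    obtain ⟨p, hp, q', hq', h⟩ := key a b (-1) (by omega) (by
      rw [h₂]; have := hbound m₂ (by positivity); nlinarith) (ih (by omega))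
    exact ⟨p, hp, q', by rwa [← add_assoc a b 1], by rw [h]; ring⟩

/-- The cofactors of the two curves cancel: `m₁ (d - 1) + m₂ (d + 1) = 0` by the choice of `d`. -/
lemma lieDeriv_firstIntegral {m₁ m₂ : ℕ} (hm₁ : 1 ≤ m₁) (hm₂ : 1 ≤ m₂) :
    lieDeriv (leadingField n (dissipation m₁ m₂)) (firstIntegral n m₁ m₂) = 0 := by
  have hm₁' : (1 : ℝ) ≤ m₁ := by exact_mod_cast hm₁
  have hm₂' : (1 : ℝ) ≤ m₂ := by exact_mod_cast hm₂
  have hd' : (m₁ : ℝ) * (dissipation m₁ m₂ - 1) + m₂ * (dissipation m₁ m₂ - (-1)) = 0 := by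
    rw [dissipation]; field_simp; ring
  have e₁ : (X 1 - X 0 ^ (n + 1) : Poly) = X 1 - C 1 * X 0 ^ (n + 1) := by simp
  have e₂ : (X 1 + X 0 ^ (n + 1) : Poly) = X 1 - C (-1) * X 0 ^ (n + 1) := by simp
  rw [firstIntegral, e₁, e₂, lieDeriv_mul,
    lieDeriv_pow_of_eq_mul (lieDeriv_leadingField_curve (by norm_num)),
    lieDeriv_pow_of_eq_mul (lieDeriv_leadingField_curve (by norm_num))]
  have h := congrArg (C (σ := Fin 2)) hd'
  simp only [C_add, C_mul, C_0] at h
  simp only [C_mul]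
  linear_combination (C ((n : ℝ) + 1) * X 0 ^ n * (X 1 - C 1 * X 0 ^ (n + 1)) ^ m₁
    * (X 1 - C (-1) * X 0 ^ (n + 1)) ^ m₂) * h

lemma firstIntegral_mem_qhPoly (m₁ m₂ : ℕ) :
    firstIntegral n m₁ m₂ ∈ qhPoly n (integralDegree n m₁ m₂) := by
  have := mul_mem_qhPoly
    (pow_mem_qhPoly (sub_mem (X_one_mem_qhPoly (n := n)) (X_zero_pow_mem_qhPoly (n + 1))) m₁)
    (pow_mem_qhPoly (add_mem (X_one_mem_qhPoly (n := n)) (X_zero_pow_mem_qhPoly (n + 1))) m₂)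
  rwa [← add_mul, mul_comm] at this

lemma exists_eq_lieDeriv_add_firstIntegral_mul {m₁ m₂ j : ℕ} (hm₁ : 1 ≤ m₁) (hm₂ : 1 ≤ m₂)
    (hj : n ≤ j) {q : Poly} (hq : q ∈ qhPoly n (j + integralDegree n m₁ m₂)) :
    ∃ p ∈ qhPoly n (j - n + integralDegree n m₁ m₂), ∃ q' ∈ qhPoly n j,
      q = lieDeriv (leadingField n (dissipation m₁ m₂)) p + firstIntegral n m₁ m₂ * q' := by
  have e : j + integralDegree n m₁ m₂ = j - n + integralDegree n m₁ m₂ + n := by omega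
  rw [e] at hq
  obtain ⟨p, hp, q', hq', h⟩ := exists_eq_lieDeriv_add_pow_mul hm₁ hm₂
    (Nat.le_add_left _ _) hq m₁ m₂ le_rfl le_rfl
  refine ⟨p, hp, q', ?_, ?_⟩
  · convert hq' using 2
    rw [← integralDegree]; omega
  · rw [h, firstIntegral]; simp

/-- Multiplying by powers of the first integral carries complements of the ranges in low degree
to complements of the ranges in all degrees. -/
lemma exists_eq_lieDeriv_add_mul_pow {m₁ m₂ : ℕ} (hm₁ : 1 ≤ m₁) (hm₂ : 1 ≤ m₂)
    {Cor : ℕ → Submodule ℝ Poly}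
    (hCor : ∀ j, n ≤ j → j ≤ integralDegree n m₁ m₂ + n - 1 →
      IsCorange n (dissipation m₁ m₂) j (Cor j)) (i : ℕ) :
    ∀ j, n ≤ j → j ≤ integralDegree n m₁ m₂ + n - 1 →
    ∀ q ∈ qhPoly n (j + i * integralDegree n m₁ m₂),
      ∃ p ∈ qhPoly n (j - n + i * integralDegree n m₁ m₂), ∃ θ ∈ Cor j,
        q = lieDeriv (leadingField n (dissipation m₁ m₂)) p + θ * firstIntegral n m₁ m₂ ^ i := by
  induction i with
  | zero =>
    intro j h₁ h₂ q hq
    rw [zero_mul, add_zero, ← (hCor j h₁ h₂).2] at hq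
    obtain ⟨θ, hθ, r, ⟨p, hp, rfl⟩, rfl⟩ := Submodule.mem_sup.1 hq
    exact ⟨p, by simpa using hp, θ, hθ, by rw [pow_zero, mul_one, add_comm]⟩
  | succ i ih =>
    intro j h₁ h₂ q hq
    rw [Nat.succ_mul, ← add_assoc] at hq
    obtain ⟨p, hp, q', hq', rfl⟩ :=
      exists_eq_lieDeriv_add_firstIntegral_mul hm₁ hm₂ (by omega) hq
    obtain ⟨p', hp', θ, hθ, rfl⟩ := ih j h₁ h₂ q' hq'
    have e : j - n + (i + 1) * integralDegree n m₁ m₂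
        = j + i * integralDegree n m₁ m₂ - n + integralDegree n m₁ m₂ := by
      rw [Nat.succ_mul]; omega
    have e' : j - n + (i + 1) * integralDegree n m₁ m₂
        = integralDegree n m₁ m₂ + (j - n + i * integralDegree n m₁ m₂) := by
      rw [Nat.succ_mul]; omega
    -- The derivation commutes with multiplication by the first integral, so the decomposition of
    -- `q'` can be multiplied by it.
    refine ⟨p + firstIntegral n m₁ m₂ * p', add_mem (e ▸ hp)
      (e' ▸ mul_mem_qhPoly (firstIntegral_mem_qhPoly _ _) hp'), θ, hθ, ?_⟩
    rw [map_add, lieDeriv_mul, lieDeriv_firstIntegral hm₁ hm₂]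
    ring

end LieDerivative

/-! ### The homological equation -/

section HomologicalEquation

open MvPolynomial

variable {n : ℕ} {d : ℝ}

/-- The Lie bracket `DU · F - DF · U`. -/
def lieBracket (F U : PolyField) : PolyField := fun i => lieDeriv F (U i) - lieDeriv U (F i)

lemma lieBracket_add (F U V : PolyField) :
    lieBracket F (U + V) = lieBracket F U + lieBracket F V := by
  funext i
  simp only [lieBracket, lieDeriv_apply, Pi.add_apply, map_add]
  ring

lemma lieDeriv_eulerField_leadingField_zero :
    lieDeriv (eulerField n) (leadingField n d 0) = C ((n : ℝ) + 1) * leadingField n d 0 := by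
  simp [lieDeriv_apply, leadingField, eulerField, pderiv_X]
  ring

lemma lieDeriv_eulerField_leadingField_one :
    lieDeriv (eulerField n) (leadingField n d 1) = C (2 * (n : ℝ) + 1) * leadingField n d 1 := by
  cases n <;> simp [lieDeriv_apply, leadingField, eulerField, pderiv_X,
    show (C 2 : Poly) = 2 from map_ofNat C 2] <;> ring

lemma lieDeriv_smul_left (b : Poly) (V : PolyField) (p : Poly) :
    lieDeriv (b • V) p = b * lieDeriv V p := by
  simp [lieDeriv_apply]; ring

/-- The bracket of the leading field with a multiple of the Euler field. -/
lemma lieDeriv_smul_eulerField (b : Poly) :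
    lieDeriv (leadingField n d) b • eulerField n
      = lieBracket (leadingField n d) (b • eulerField n) + (C (n : ℝ) * b) • leadingField n d := by
  funext i
  simp only [lieBracket, Pi.smul_apply, Pi.add_apply, smul_eq_mul, lieDeriv_smul_left,
    lieDeriv_mul]
  have h₀ : lieDeriv (leadingField n d) (eulerField n 0) = leadingField n d 0 := by
    simp [lieDeriv_apply, eulerField, pderiv_X]
  have h₁ : lieDeriv (leadingField n d) (eulerField n 1)
      = C ((n : ℝ) + 1) * leadingField n d 1 := by
    simp [lieDeriv_apply, eulerField, pderiv_X]; ring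
  fin_cases i
  · simp only [Fin.zero_eta, h₀, lieDeriv_eulerField_leadingField_zero, C_add, C_1]; ring
  · simp only [Fin.mk_one, h₁, lieDeriv_eulerField_leadingField_one, C_add, C_1, C_mul, map_ofNat]
    ring

/-- Modulo combinations of the leading field and the Euler field, a quasi-homogeneous field of
degree `s + n` is the field `(a x ^ (s + n + 1), b x ^ (s + 2 n + 1))`. -/
def ReducesToMonomials (n : ℕ) (d : ℝ) (s : ℕ) (V : PolyField) : Prop :=
  ∃ α ∈ qhPoly n s, ∃ β ∈ qhPoly n (s + n), ∃ a b : ℝ,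
    V 0 = α * leadingField n d 0 + β * eulerField n 0 + C a * X 0 ^ (s + n + 1) ∧
    V 1 = α * leadingField n d 1 + β * eulerField n 1 + C b * X 0 ^ (s + 2 * n + 1)

lemma ReducesToMonomials.add {s : ℕ} {V W : PolyField} (hV : ReducesToMonomials n d s V)
    (hW : ReducesToMonomials n d s W) : ReducesToMonomials n d s (V + W) := by
  obtain ⟨α, hα, β, hβ, a, b, h₀, h₁⟩ := hV
  obtain ⟨α', hα', β', hβ', a', b', h₀', h₁'⟩ := hW
  refine ⟨α + α', add_mem hα hα', β + β', add_mem hβ hβ', a + a', b + b', ?_, ?_⟩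
  · rw [Pi.add_apply, h₀, h₀', C_add]; ring
  · rw [Pi.add_apply, h₁, h₁', C_add]; ring

lemma ReducesToMonomials.zero (s : ℕ) : ReducesToMonomials n d s 0 :=
  ⟨0, zero_mem _, 0, zero_mem _, 0, 0, by simp, by simp⟩

lemma ReducesToMonomials.C_smul {s : ℕ} {V : PolyField} (c : ℝ)
    (hV : ReducesToMonomials n d s V) : ReducesToMonomials n d s ((C c : Poly) • V) := by
  obtain ⟨α, hα, β, hβ, a, b, h₀, h₁⟩ := hV
  refine ⟨C c * α, C_mul_mem_qhPoly _ hα, C c * β, C_mul_mem_qhPoly _ hβ, c * a, c * b, ?_, ?_⟩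
  · rw [Pi.smul_apply, smul_eq_mul, h₀, C_mul]; ring
  · rw [Pi.smul_apply, smul_eq_mul, h₁, C_mul]; ring

lemma ReducesToMonomials.smul_leadingField {s : ℕ} {α : Poly} (hα : α ∈ qhPoly n s) :
    ReducesToMonomials n d s (α • leadingField n d) :=
  ⟨α, hα, 0, zero_mem _, 0, 0, by simp, by simp⟩

lemma ReducesToMonomials.smul_eulerField {s : ℕ} {β : Poly} (hβ : β ∈ qhPoly n (s + n)) :
    ReducesToMonomials n d s (β • eulerField n) :=
  ⟨0, zero_mem _, β, hβ, 0, 0, by simp, by simp⟩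

/-- Induction on the exponent of `y`: the second component of `D₀` trades a `y` there for an `x` in
the first component, and the first component of `Fₙ` trades a `y` for `-d x ^ (n + 1)` and terms in
the second component. One of these keeps the power `b + 1` of `y`, so the second component is
treated first. -/
lemma reducesToMonomials_monomial (s b : ℕ) :
    (∀ a, a + (n + 1) * b = s + n + 1 →
      ReducesToMonomials n d s ![X 0 ^ a * X 1 ^ b, 0]) ∧
    (∀ a, a + (n + 1) * b = s + 2 * n + 1 →
      ReducesToMonomials n d s ![0, X 0 ^ a * X 1 ^ b]) := by
  induction b with
  | zero =>
    constructor
    · intro a h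
      refine ⟨0, zero_mem _, 0, zero_mem _, 1, 0, ?_, ?_⟩ <;> simp [← h]
    · intro a h
      refine ⟨0, zero_mem _, 0, zero_mem _, 0, 1, ?_, ?_⟩ <;> simp [← h]
  | succ b ih =>
    have hn : ((n : ℝ) + 1) ≠ 0 := by positivity
    have hC : (C ((n : ℝ) + 1)⁻¹ : Poly) * (C (n : ℝ) + 1) = 1 := by
      rw [← C_1, ← C_add, ← C_mul, inv_mul_cancel₀ hn]
    have h₂ : ∀ a, a + (n + 1) * (b + 1) = s + 2 * n + 1 →
        ReducesToMonomials n d s ![0, X 0 ^ a * X 1 ^ (b + 1)] := by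
      intro a h
      have e : (![0, X 0 ^ a * X 1 ^ (b + 1)] : PolyField)
          = (C ((n : ℝ) + 1)⁻¹ * (X 0 ^ a * X 1 ^ b) : Poly) • eulerField n
            + (C (-((n : ℝ) + 1)⁻¹) : Poly) • ![X 0 ^ (a + 1) * X 1 ^ b, 0] := by
        funext i
        fin_cases i
        · simp only [Fin.zero_eta, Pi.add_apply, Pi.smul_apply, smul_eq_mul, eulerField,
            Matrix.cons_val_zero, C_neg]
          ring
        · simp only [Fin.mk_one, Pi.add_apply, Pi.smul_apply, smul_eq_mul, eulerField,
            Matrix.cons_val_one, Matrix.cons_val_fin_one, C_add, C_1]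
          linear_combination (- X 0 ^ a * X 1 ^ (b + 1)) * hC
      rw [mul_add] at h
      rw [e]
      exact (ReducesToMonomials.smul_eulerField (C_mul_mem_qhPoly _
        (X_pow_mul_X_pow_mem_qhPoly (by omega)))).add
        ((ih.1 (a + 1) (by omega)).C_smul _)
    refine ⟨fun a h => ?_, h₂⟩
    have e : (![X 0 ^ a * X 1 ^ (b + 1), 0] : PolyField)
        = (X 0 ^ a * X 1 ^ b : Poly) • leadingField n d
          + (C (-d) : Poly) • ![X 0 ^ (a + n + 1) * X 1 ^ b, 0]
          + (C (-((n : ℝ) + 1)) : Poly) • ![0, X 0 ^ (a + 2 * n + 1) * X 1 ^ b]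
          + (C (-(((n : ℝ) + 1) * d)) : Poly) • ![0, X 0 ^ (a + n) * X 1 ^ (b + 1)] := by
      funext i
      fin_cases i
      · simp [leadingField]; ring
      · simp [leadingField]; ring
    rw [e]
    have h' := h
    rw [mul_add] at h'
    exact (((ReducesToMonomials.smul_leadingField (X_pow_mul_X_pow_mem_qhPoly (by omega))).add
      ((ih.1 _ (by omega)).C_smul _)).add ((ih.2 _ (by omega)).C_smul _)).add
      ((h₂ _ (by omega)).C_smul _)

lemma IsQHField.reducesToMonomials {s : ℕ} {V : PolyField} (hV : IsQHField n (s + n) V) :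
    ReducesToMonomials n d s V := by
  have h₀ : ReducesToMonomials n d s ![V 0, 0] := by
    refine qhPoly_induction (P := fun p => ReducesToMonomials n d s ![p, 0]) ?_ ?_ ?_ (hV 0)
    · convert ReducesToMonomials.zero s using 1
      funext i; fin_cases i <;> rfl
    · intro p q hp hq
      simpa using hp.add hq
    · intro c a b h
      simpa using ((reducesToMonomials_monomial s b).1 a h).C_smul c
  have h₁ : ReducesToMonomials n d s ![0, V 1] := by
    refine qhPoly_induction (P := fun p => ReducesToMonomials n d s ![0, p]) ?_ ?_ ?_ (hV 1)
    · convert ReducesToMonomials.zero s using 1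
      funext i; fin_cases i <;> rfl
    · intro p q hp hq
      simpa using hp.add hq
    · intro c a b h
      simpa using ((reducesToMonomials_monomial s b).2 a (by
        simp only [wt, Matrix.cons_val_one, Matrix.cons_val_fin_one] at h; omega)).C_smul c
  convert h₀.add h₁ using 1
  funext i; fin_cases i <;> simp

/-- The field `(u x ^ (s + 1), v x ^ (s + n + 1))`. -/
def monomialField (n s : ℕ) (u v : ℝ) : PolyField :=
  ![C u * X 0 ^ (s + 1), C v * X 0 ^ (s + n + 1)]

lemma lieBracket_leadingField_monomialField (s : ℕ) (u v : ℝ) :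
    lieBracket (leadingField n d) (monomialField n s u v)
      = (C (u * (s + 1)) * X 0 ^ s : Poly) • leadingField n d
        + (C ((s + n + 1) * (v / (n + 1) - d * u)) * X 0 ^ (s + n) : Poly) • eulerField n
        + (![C (u * d * s - v * (s + 2 * n + 2) / (n + 1)) * X 0 ^ (s + n + 1),
            C (v * s * d - u * (n + 1) * (s + 2 * n + 2)) * X 0 ^ (s + 2 * n + 1)] :
              PolyField) := by
  have hn : ((n : ℝ) + 1) ≠ 0 := by positivity
  -- Writing `v = (n + 1) w` clears the denominators before the polynomial identity is checked.
  obtain ⟨w, rfl⟩ : ∃ w, v = (n + 1) * w := ⟨v / (n + 1), by field_simp⟩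
  have e₁ : ((n : ℝ) + 1) * w / (n + 1) = w := by field_simp
  have e₂ : ((n : ℝ) + 1) * w * (s + 2 * n + 2) / (n + 1) = w * (s + 2 * n + 2) := by field_simp
  rw [e₁, e₂]
  funext i
  fin_cases i
  · simp [lieBracket, lieDeriv_apply, leadingField, eulerField, monomialField, pderiv_X,
      show (C 2 : Poly) = 2 from map_ofNat C 2]
    ring
  · cases n <;>
    simp [lieBracket, lieDeriv_apply, leadingField, eulerField, monomialField, pderiv_X,
      show (C 2 : Poly) = 2 from map_ofNat C 2] <;>
    ring

/-- The homological equation. -/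
lemma exists_homological {s : ℕ} (hd : d ^ 2 ≤ 1) {C' : Submodule ℝ Poly}
    (hC : ∀ q ∈ qhPoly n (s + n), ∃ p ∈ qhPoly n s, ∃ θ ∈ C',
      q = lieDeriv (leadingField n d) p + θ) {V : PolyField} (hV : IsQHField n (s + n) V) :
    ∃ U, IsQHField n s U ∧ ∃ α ∈ qhPoly n s, ∃ θ ∈ C',
      V = α • leadingField n d + θ • eulerField n + lieBracket (leadingField n d) U := by
  obtain ⟨α, hα, β, hβ, a, b, h₀, h₁⟩ := hV.reducesToMonomials (d := d)
  -- Cramer's rule; the determinant is negative because `s² d² ≤ s² < (s + 2n + 2)²`.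
  obtain ⟨u, v, hu, hv⟩ : ∃ u v : ℝ, u * d * s - v * (s + 2 * n + 2) / (n + 1) = a ∧
      v * s * d - u * (n + 1) * (s + 2 * n + 2) = b := by
    have hn : ((n : ℝ) + 1) ≠ 0 := by positivity
    have hΔ : (s : ℝ) ^ 2 * d ^ 2 - (s + 2 * n + 2) ^ 2 ≠ 0 := by
      have : (s : ℝ) ^ 2 * d ^ 2 ≤ s ^ 2 := mul_le_of_le_one_right (by positivity) hd
      have : (0 : ℝ) ≤ n := by positivity
      have : (0 : ℝ) ≤ s := by positivity
      nlinarith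
    obtain ⟨Δ, hΔ'⟩ : ∃ Δ : ℝ, Δ = (s : ℝ) ^ 2 * d ^ 2 - (s + 2 * n + 2) ^ 2 := ⟨_, rfl⟩
    rw [← hΔ'] at hΔ
    refine ⟨(s * d * a + (s + 2 * n + 2) / (n + 1) * b) / Δ,
      ((n + 1) * (s + 2 * n + 2) * a + s * d * b) / Δ, ?_, ?_⟩
    · field_simp; rw [hΔ']; ring
    · field_simp; rw [hΔ']; ring
  have hUV := lieBracket_leadingField_monomialField (d := d) (n := n) s u v
  rw [hu, hv] at hUV
  -- The monomial field has its own `D₀` part, which is subtracted from `β` before projecting to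
  -- `C'`.
  obtain ⟨p, hp, θ, hθ, h⟩ := hC
    (β - C ((s + n + 1) * (v / (n + 1) - d * u)) * X 0 ^ (s + n))
    (sub_mem hβ (C_mul_mem_qhPoly _ (X_zero_pow_mem_qhPoly _)))
  have hp' := lieDeriv_smul_eulerField (n := n) (d := d) p
  refine ⟨monomialField n s u v + p • eulerField n, ?_,
    α - C (u * (s + 1)) * X 0 ^ s + C (n : ℝ) * p,
    add_mem (sub_mem hα (C_mul_mem_qhPoly _ (X_zero_pow_mem_qhPoly _))) (C_mul_mem_qhPoly _ hp),
    θ, hθ, ?_⟩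
  · intro i
    refine add_mem ?_ (mul_mem_qhPoly hp ?_)
    · fin_cases i
      · exact C_mul_mem_qhPoly _ (X_zero_pow_mem_qhPoly _)
      · exact C_mul_mem_qhPoly _ (X_zero_pow_mem_qhPoly _)
    · fin_cases i
      · exact X_zero_mem_qhPoly
      · exact C_mul_mem_qhPoly _ X_one_mem_qhPoly
  · rw [lieBracket_add, hUV]
    have h' : β = C ((s + n + 1) * (v / (n + 1) - d * u)) * X 0 ^ (s + n)
        + (lieDeriv (leadingField n d) p + θ) := by rw [← h]; ring
    funext i
    have hp'' := congrFun hp' i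
    simp only [Pi.add_apply, Pi.smul_apply, smul_eq_mul] at hp'' ⊢
    fin_cases i
    · simp only [Fin.zero_eta, Matrix.cons_val_zero] at hp'' ⊢
      rw [h₀, h']; linear_combination hp''
    · simp only [Fin.mk_one, Matrix.cons_val_one, Matrix.cons_val_fin_one] at hp'' ⊢
      rw [h₁, h']; linear_combination hp''

end HomologicalEquation

/-! ### The weight filtration on formal power series -/

section Filtration

open MvPowerSeries

variable {n : ℕ}

/-- The ideal of formal power series all of whose monomials have weight at least `k`. -/
def wtIdeal (n k : ℕ) : Ideal Ser where
  carrier := {p | ∀ e, Finsupp.weight (wt n) e < k → coeff e p = 0}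
  zero_mem' := fun e _ => by simp
  add_mem' := fun {p q} hp hq e he => by rw [map_add, hp e he, hq e he, add_zero]
  smul_mem' := fun c p hp e he => by
    rw [smul_eq_mul, coeff_mul]
    refine Finset.sum_eq_zero fun x hx => ?_
    rw [← Finset.HasAntidiagonal.mem_antidiagonal.1 hx, map_add] at he
    rw [hp _ (by omega), mul_zero]

lemma wtIdeal_mono {k l : ℕ} (h : k ≤ l) : wtIdeal n l ≤ wtIdeal n k :=
  fun _ hp e he => hp e (he.trans_le h)

lemma mem_wtIdeal_zero (p : Ser) : p ∈ wtIdeal n 0 := fun _ he => absurd he (Nat.not_lt_zero _)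

lemma mul_mem_wtIdeal {k l : ℕ} {p q : Ser} (hp : p ∈ wtIdeal n k) (hq : q ∈ wtIdeal n l) :
    p * q ∈ wtIdeal n (k + l) := by
  intro e he
  rw [coeff_mul]
  refine Finset.sum_eq_zero fun x hx => ?_
  rw [← Finset.HasAntidiagonal.mem_antidiagonal.1 hx, map_add] at he
  by_cases h : Finsupp.weight (wt n) x.1 < k
  · rw [hp _ h, zero_mul]
  · rw [hq _ (by omega), mul_zero]

lemma pow_mem_wtIdeal {k : ℕ} {p : Ser} (hp : p ∈ wtIdeal n k) (a : ℕ) :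
    p ^ a ∈ wtIdeal n (a * k) := by
  induction a with
  | zero => simpa using mem_wtIdeal_zero _
  | succ a ih => rw [pow_succ, Nat.succ_mul]; exact mul_mem_wtIdeal ih hp

lemma coe_mem_wtIdeal {k : ℕ} {p : Poly} (hp : p ∈ qhPoly n k) : (p : Ser) ∈ wtIdeal n k := by
  intro e he
  rw [MvPolynomial.coeff_coe]
  by_contra h
  exact he.ne (hp h)

lemma eq_zero_of_forall_mem_wtIdeal {p : Ser} (hp : ∀ k, p ∈ wtIdeal n k) : p = 0 := by
  ext e
  exact hp _ e (Nat.lt_succ_self _)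

lemma pderiv_mem_wtIdeal {k : ℕ} {p : Ser} (i : Fin 2) (hp : p ∈ wtIdeal n (k + wt n i)) :
    pderiv ℝ i p ∈ wtIdeal n k := by
  intro e he
  rw [coeff_pderiv, hp, zero_mul]
  rw [map_add, Finsupp.weight_single, one_smul]
  omega

/-- The part of weight `k` of a power series with only monomials of weight at least `k`. -/
lemma exists_qhPoly_sub_mem_wtIdeal {k : ℕ} {p : Ser} (hp : p ∈ wtIdeal n k) :
    ∃ q ∈ qhPoly n k, p - (q : Ser) ∈ wtIdeal n (k + 1) := by
  have hfin : {e : Fin 2 →₀ ℕ | Finsupp.weight (wt n) e ≤ k}.Finite :=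
    Finsupp.finite_of_nat_weight_le _ (by intro i; fin_cases i <;> simp [wt]) _
  refine ⟨∑ e ∈ hfin.toFinset with Finsupp.weight (wt n) e = k,
    MvPolynomial.monomial e (coeff e p), Submodule.sum_mem _ fun e he =>
      MvPolynomial.isWeightedHomogeneous_monomial _ _ _ (Finset.mem_filter.1 he).2, ?_⟩
  intro e he
  rw [map_sub, MvPolynomial.coeff_coe, MvPolynomial.coeff_sum]
  simp only [MvPolynomial.coeff_monomial]
  rw [Finset.sum_ite_eq']
  split_ifs with h
  · exact sub_self _
  · rw [hp, sub_zero]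
    have : Finsupp.weight (wt n) e ≤ k := by omega
    have : Finsupp.weight (wt n) e ≠ k := fun h' => h (by simp [h'])
    omega

/-- A map all of whose monomials have at least the weight of the corresponding variable. -/
def WtMap (n : ℕ) (Φ : Fin 2 → Ser) : Prop := ∀ i, Φ i ∈ wtIdeal n (wt n i)

lemma one_le_wt (n : ℕ) (i : Fin 2) : 1 ≤ wt n i := by fin_cases i <;> simp [wt]

lemma constantCoeff_eq_zero_of_mem_wtIdeal {k : ℕ} {p : Ser} (hp : p ∈ wtIdeal n (k + 1)) :
    constantCoeff p = 0 := by
  rw [← coeff_zero_eq_constantCoeff_apply]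
  exact hp _ (by simp)

lemma WtMap.hasSubst {Φ : Fin 2 → Ser} (hΦ : WtMap n Φ) : HasSubst Φ :=
  hasSubst_of_constantCoeff_zero fun i =>
    constantCoeff_eq_zero_of_mem_wtIdeal (k := 0) (wtIdeal_mono (one_le_wt n i) (hΦ i))

lemma WtMap.prod_mem {Φ : Fin 2 → Ser} (hΦ : WtMap n Φ) (e : Fin 2 →₀ ℕ) :
    (e.prod fun i a => Φ i ^ a) ∈ wtIdeal n (Finsupp.weight (wt n) e) := by
  rw [Finsupp.prod_fintype _ _ (by simp), Fin.prod_univ_two, Finsupp.weight_eq_sum,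
    Fin.sum_univ_two]
  exact mul_mem_wtIdeal (pow_mem_wtIdeal (hΦ 0) _) (pow_mem_wtIdeal (hΦ 1) _)

lemma WtMap.subst_mem {Φ : Fin 2 → Ser} (hΦ : WtMap n Φ) {k : ℕ} {p : Ser}
    (hp : p ∈ wtIdeal n k) : subst Φ p ∈ wtIdeal n k := by
  intro e he
  rw [coeff_subst hΦ.hasSubst]
  refine finsum_eq_zero_of_forall_eq_zero fun x => ?_
  by_cases h : Finsupp.weight (wt n) x < k
  · rw [hp x h, zero_smul]
  · rw [hΦ.prod_mem x e (by omega), smul_zero]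

lemma mul_sub_mul_mem_wtIdeal {k l s : ℕ} {p q p' q' : Ser} (hp : p ∈ wtIdeal n k)
    (hq' : q' ∈ wtIdeal n l) (h : p' - p ∈ wtIdeal n (k + s)) (h' : q' - q ∈ wtIdeal n (l + s)) :
    p' * q' - p * q ∈ wtIdeal n (k + l + s) := by
  have e : p' * q' - p * q = (p' - p) * q' + p * (q' - q) := by ring
  rw [e]
  have h₁ := mul_mem_wtIdeal h hq'
  have h₂ := mul_mem_wtIdeal hp h'
  refine add_mem ?_ ?_
  · convert h₁ using 2; ring
  · convert h₂ using 2; ring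

lemma pow_sub_pow_mem_wtIdeal {k s : ℕ} {p p' : Ser} (hp : p ∈ wtIdeal n k)
    (hp' : p' ∈ wtIdeal n k) (h : p' - p ∈ wtIdeal n (k + s)) (a : ℕ) :
    p' ^ a - p ^ a ∈ wtIdeal n (a * k + s) := by
  induction a with
  | zero => simp
  | succ a ih =>
    rw [pow_succ, pow_succ, Nat.succ_mul]
    exact mul_sub_mul_mem_wtIdeal (pow_mem_wtIdeal hp a) hp' ih h

/-- Telescoping shows that a change of relative weight `s` in each variable changes a monomial of
weight `w` only from weight `w + s` on. -/
lemma subst_sub_subst_mem_wtIdeal {Φ Ψ : Fin 2 → Ser} (hΦ : WtMap n Φ) (hΨ : WtMap n Ψ) {s k : ℕ}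
    (h : ∀ i, Ψ i - Φ i ∈ wtIdeal n (wt n i + s)) {p : Ser} (hp : p ∈ wtIdeal n k) :
    subst Ψ p - subst Φ p ∈ wtIdeal n (k + s) := by
  intro e he
  rw [map_sub, coeff_subst hΦ.hasSubst, coeff_subst hΨ.hasSubst,
    ← finsum_sub_distrib (coeff_subst_finite hΨ.hasSubst p e)
      (coeff_subst_finite hΦ.hasSubst p e)]
  refine finsum_eq_zero_of_forall_eq_zero fun x => ?_
  by_cases hx : Finsupp.weight (wt n) x < k
  · rw [hp x hx, zero_smul, zero_smul, sub_zero]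
  · have key : (x.prod fun i a => Ψ i ^ a) - (x.prod fun i a => Φ i ^ a)
        ∈ wtIdeal n (Finsupp.weight (wt n) x + s) := by
      rw [Finsupp.prod_fintype _ _ (by simp), Finsupp.prod_fintype _ _ (by simp),
        Fin.prod_univ_two, Fin.prod_univ_two, Finsupp.weight_eq_sum, Fin.sum_univ_two]
      exact mul_sub_mul_mem_wtIdeal (pow_mem_wtIdeal (hΦ 0) _) (pow_mem_wtIdeal (hΨ 1) _)
        (pow_sub_pow_mem_wtIdeal (hΦ 0) (hΨ 0) (h 0) _)
        (pow_sub_pow_mem_wtIdeal (hΦ 1) (hΨ 1) (h 1) _)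
    rw [← smul_sub, ← map_sub, key e (by omega), smul_zero]

/-- A map tangent to the identity, with respect to the weights. -/
def TangentToId (n : ℕ) (Φ : Fin 2 → Ser) : Prop := ∀ i, Φ i - X i ∈ wtIdeal n (wt n i + 1)

lemma X_mem_wtIdeal (i : Fin 2) : (X i : Ser) ∈ wtIdeal n (wt n i) := by
  rw [← MvPolynomial.coe_X]
  exact coe_mem_wtIdeal (MvPolynomial.isWeightedHomogeneous_X ℝ (wt n) i)

lemma TangentToId.wtMap {Φ : Fin 2 → Ser} (hΦ : TangentToId n Φ) : WtMap n Φ := fun i => by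
  have := add_mem (wtIdeal_mono (Nat.le_succ _) (hΦ i)) (X_mem_wtIdeal i)
  rwa [sub_add_cancel] at this

lemma TangentToId.subst_sub_mem {Φ : Fin 2 → Ser} (hΦ : TangentToId n Φ) {k : ℕ} {p : Ser}
    (hp : p ∈ wtIdeal n k) : subst Φ p - p ∈ wtIdeal n (k + 1) := by
  have h := subst_sub_subst_mem_wtIdeal (Φ := X) X_mem_wtIdeal hΦ.wtMap hΦ hp
  rwa [subst_self] at h

lemma TangentToId.add {Φ φ : Fin 2 → Ser} (hΦ : TangentToId n Φ) {s : ℕ} (hs : 1 ≤ s)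
    (hφ : ∀ i, φ i ∈ wtIdeal n (wt n i + s)) : TangentToId n (Φ + φ) := fun i => by
  rw [Pi.add_apply, add_sub_right_comm]
  exact add_mem (hΦ i) (wtIdeal_mono (by omega) (hφ i))

/-- The first order Taylor remainder of a substitution. -/
def taylorRemainder (Φ φ : Fin 2 → Ser) (p : Poly) : Ser :=
  subst (Φ + φ) (p : Ser) - subst Φ (p : Ser) - ∑ i, φ i * (MvPolynomial.pderiv i p : Ser)

/-- The linear term is a derivation and substitution is multiplicative, so the remainder of a
product consists of remainders and of products of a linear term with a deviation from the identity.
-/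
lemma taylorRemainder_mul_mem {Φ φ : Fin 2 → Ser} (hΦ : TangentToId n Φ) {s k l : ℕ} (hs : 1 ≤ s)
    (hφ : ∀ i, φ i ∈ wtIdeal n (wt n i + s)) {p q : Poly} (hp : p ∈ qhPoly n k)
    (hq : q ∈ qhPoly n l) (h : taylorRemainder Φ φ p ∈ wtIdeal n (k + s + 1))
    (h' : taylorRemainder Φ φ q ∈ wtIdeal n (l + s + 1)) :
    taylorRemainder Φ φ (p * q) ∈ wtIdeal n (k + l + s + 1) := by
  have hΨ : TangentToId n (Φ + φ) := hΦ.add hs hφ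
  have hdiff : ∀ i, (Φ + φ) i - Φ i ∈ wtIdeal n (wt n i + s) := fun i => by
    simpa using hφ i
  have hp' := coe_mem_wtIdeal hp
  have hq' := coe_mem_wtIdeal hq
  have hlin : ∀ {m : ℕ} {r : Poly}, r ∈ qhPoly n m →
      taylorRemainder Φ φ r ∈ wtIdeal n (m + s + 1) →
      ∑ i, φ i * (MvPolynomial.pderiv i r : Ser) ∈ wtIdeal n (m + s) := by
    intro m r hr hr'
    have := sub_mem (subst_sub_subst_mem_wtIdeal hΦ.wtMap hΨ.wtMap hdiff (coe_mem_wtIdeal hr))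
      (wtIdeal_mono (Nat.le_succ _) hr')
    rwa [taylorRemainder, sub_sub_cancel] at this
  have e : taylorRemainder Φ φ (p * q)
      = taylorRemainder Φ φ p * subst (Φ + φ) (q : Ser)
        + (∑ i, φ i * (MvPolynomial.pderiv i p : Ser)) * (subst (Φ + φ) (q : Ser) - q)
        + subst Φ (p : Ser) * taylorRemainder Φ φ q
        + (subst Φ (p : Ser) - p) * ∑ i, φ i * (MvPolynomial.pderiv i q : Ser) := by
    simp only [taylorRemainder, MvPolynomial.coe_mul, subst_mul hΦ.wtMap.hasSubst,
      subst_mul hΨ.wtMap.hasSubst, Fin.sum_univ_two, MvPolynomial.pderiv_mul,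
      MvPolynomial.coe_add]
    ring
  rw [e]
  have h₁ := mul_mem_wtIdeal h (hΨ.wtMap.subst_mem hq')
  have h₂ := mul_mem_wtIdeal (hlin hp h) (hΨ.subst_sub_mem hq')
  have h₃ := mul_mem_wtIdeal (hΦ.wtMap.subst_mem hp') h'
  have h₄ := mul_mem_wtIdeal (hΦ.subst_sub_mem hp') (hlin hq h')
  refine add_mem (add_mem (add_mem ?_ ?_) ?_) ?_
  · exact wtIdeal_mono (by omega) h₁
  · exact wtIdeal_mono (by omega) h₂
  · exact wtIdeal_mono (by omega) h₃
  · exact wtIdeal_mono (by omega) h₄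

lemma taylorRemainder_X {Φ φ : Fin 2 → Ser} (hΦ : HasSubst Φ) (hΨ : HasSubst (Φ + φ))
    (j : Fin 2) : taylorRemainder Φ φ (MvPolynomial.X j) = 0 := by
  simp only [taylorRemainder, MvPolynomial.coe_X, subst_X hΦ, subst_X hΨ, Fin.sum_univ_two,
    MvPolynomial.pderiv_X]
  fin_cases j <;> simp

lemma taylorRemainder_C (Φ φ : Fin 2 → Ser) (c : ℝ) :
    taylorRemainder Φ φ (MvPolynomial.C c) = 0 := by
  simp [taylorRemainder]

lemma taylorRemainder_add {Φ φ : Fin 2 → Ser} (hΦ : HasSubst Φ) (hΨ : HasSubst (Φ + φ))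
    (p q : Poly) :
    taylorRemainder Φ φ (p + q) = taylorRemainder Φ φ p + taylorRemainder Φ φ q := by
  simp only [taylorRemainder, MvPolynomial.coe_add, subst_add hΦ, subst_add hΨ, map_add,
    Fin.sum_univ_two]
  ring

/-- The linear term uses the derivatives of `p` without composing them with `Φ`; as `Φ` is tangent
to the identity, this costs only terms of higher weight. The bound passes from the variables to
products and sums. -/
lemma taylorRemainder_mem {Φ φ : Fin 2 → Ser} (hΦ : TangentToId n Φ) {s k : ℕ} (hs : 1 ≤ s)
    (hφ : ∀ i, φ i ∈ wtIdeal n (wt n i + s)) {p : Poly} (hp : p ∈ qhPoly n k) :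
    taylorRemainder Φ φ p ∈ wtIdeal n (k + s + 1) := by
  have h₁ := hΦ.wtMap.hasSubst
  have h₂ := (hΦ.add hs hφ).wtMap.hasSubst
  have hone : taylorRemainder Φ φ 1 = 0 := by
    rw [← MvPolynomial.C_1, taylorRemainder_C]
  have hX : ∀ (j : Fin 2) (a : ℕ),
      taylorRemainder Φ φ (MvPolynomial.X j ^ a) ∈ wtIdeal n (a * wt n j + s + 1) := by
    intro j a
    have hj : (MvPolynomial.X j : Poly) ∈ qhPoly n (wt n j) :=
      MvPolynomial.isWeightedHomogeneous_X ℝ (wt n) j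
    induction a with
    | zero => rw [pow_zero, hone]; exact zero_mem _
    | succ a ih =>
      rw [pow_succ, Nat.succ_mul]
      exact taylorRemainder_mul_mem hΦ hs hφ (pow_mem_qhPoly hj a) hj ih
        (by rw [taylorRemainder_X h₁ h₂]; exact zero_mem _)
  refine qhPoly_induction (P := fun p => taylorRemainder Φ φ p ∈ wtIdeal n (k + s + 1))
    ?_ ?_ ?_ hp
  · rw [← MvPolynomial.C_0, taylorRemainder_C]; exact zero_mem _
  · intro p q hp hq
    rw [taylorRemainder_add h₁ h₂]
    exact add_mem hp hq
  · intro c a b h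
    have hab := taylorRemainder_mul_mem hΦ hs hφ (X_zero_pow_mem_qhPoly a)
      (pow_mem_qhPoly X_one_mem_qhPoly b) (by simpa [wt] using hX 0 a) (hX 1 b)
    have hc := taylorRemainder_mul_mem (k := 0) hΦ hs hφ (p := MvPolynomial.C c)
      (MvPolynomial.isWeightedHomogeneous_C _ _)
      (mul_mem_qhPoly (X_zero_pow_mem_qhPoly a) (pow_mem_qhPoly X_one_mem_qhPoly b))
      (by rw [taylorRemainder_C]; exact zero_mem _) hab
    rwa [zero_add, mul_comm b, h] at hc

/-- Sequences that converge with respect to the filtration have a limit. -/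
lemma exists_limit {u : ℕ → Ser} {c : ℕ} (hu : ∀ s, u (s + 1) - u s ∈ wtIdeal n (c + s)) :
    ∃ v : Ser, ∀ s, v - u s ∈ wtIdeal n (c + s) := by
  have hst : ∀ s t, u (s + t) - u s ∈ wtIdeal n (c + s) := by
    intro s t
    induction t with
    | zero => simp
    | succ t ih =>
      have := add_mem (wtIdeal_mono (by omega) (hu (s + t))) ih
      rwa [sub_add_sub_cancel] at this
  -- A coefficient of weight `w` is constant along the sequence from index `w + 1` on.
  let v : Ser := fun e => coeff e (u (Finsupp.weight (wt n) e + 1))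
  have hv : ∀ e, coeff e v = coeff e (u (Finsupp.weight (wt n) e + 1)) := fun _ => rfl
  refine ⟨v, fun s e he => ?_⟩
  rw [map_sub, hv]
  rcases le_total s (Finsupp.weight (wt n) e + 1) with h | h
  · obtain ⟨t, ht⟩ := Nat.exists_eq_add_of_le h
    rw [ht, ← map_sub]
    exact hst s t e he
  · obtain ⟨t, ht⟩ := Nat.exists_eq_add_of_le h
    rw [ht, ← neg_sub, ← map_sub, hst _ t e (by omega), neg_zero]

lemma hasSum_of_forall_sub_mem_wtIdeal {f : ℕ → Ser} {p : Ser}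
    (h : ∀ N, p - ∑ i ∈ Finset.range N, f i ∈ wtIdeal n N) : HasSum f p := by
  rw [WithPiTopology.hasSum_iff_hasSum_coeff]
  intro e
  have hp : ∀ N, Finsupp.weight (wt n) e < N →
      coeff e p = ∑ i ∈ Finset.range N, coeff e (f i) := by
    intro N hN
    rw [← map_sum, ← sub_eq_zero, ← map_sub, h N e hN]
  rw [hp _ (Nat.lt_succ_self _)]
  refine hasSum_sum_of_ne_finset_zero fun i hi => ?_
  rw [Finset.mem_range, not_lt] at hi
  have h' := hp (i + 1) (by omega)
  rw [Finset.sum_range_succ, ← hp i (by omega)] at h'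
  simpa using h'

end Filtration

/-! ### Degree by degree construction and passage to the limit -/

section Recursion

open MvPowerSeries

variable {n : ℕ} {d : ℝ}

lemma leadingField_mem_qhPoly (i : Fin 2) : leadingField n d i ∈ qhPoly n (n + wt n i) := by
  fin_cases i
  · exact add_mem X_one_mem_qhPoly (C_mul_mem_qhPoly _ (X_zero_pow_mem_qhPoly _))
  · refine add_mem (C_mul_mem_qhPoly _ ?_) (C_mul_mem_qhPoly _ ?_)
    · convert X_zero_pow_mem_qhPoly (n := n) (2 * n + 1) using 2
      simp [wt]; ring
    · exact mul_mem_qhPoly (X_zero_pow_mem_qhPoly n) X_one_mem_qhPoly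

lemma eulerField_mem_qhPoly (i : Fin 2) : eulerField n i ∈ qhPoly n (wt n i) := by
  fin_cases i
  · exact X_zero_mem_qhPoly
  · exact C_mul_mem_qhPoly _ X_one_mem_qhPoly

/-- The weight lost by differentiating is regained from the component of the field. If `k` is below
the weight of the variable, the weight of `q` alone suffices, so truncated subtraction does no harm.
-/
lemma pderiv_mul_mem_wtIdeal {k l : ℕ} {p q : Ser} (j : Fin 2) (hp : p ∈ wtIdeal n k)
    (hq : q ∈ wtIdeal n (l + wt n j)) : pderiv ℝ j p * q ∈ wtIdeal n (k + l) := by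
  rcases le_total (wt n j) k with h | h
  · obtain ⟨k', rfl⟩ := Nat.exists_eq_add_of_le' h
    exact wtIdeal_mono (by omega) (mul_mem_wtIdeal (pderiv_mem_wtIdeal j hp) hq)
  · exact wtIdeal_mono (by omega) (Ideal.mul_mem_left _ _ hq)

lemma sum_pderiv_X_mul (i : Fin 2) (q : Fin 2 → Ser) :
    ∑ j, pderiv ℝ j (X i : Ser) * q j = q i := by
  rw [Fin.sum_univ_two, ← MvPolynomial.coe_X, pderiv_coe, pderiv_coe]
  fin_cases i <;> simp [MvPolynomial.pderiv_X]

lemma coe_poly_sub (p q : Poly) : ((p - q : Poly) : Ser) = p - q :=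
  map_sub MvPolynomial.coeToMvPowerSeries.ringHom p q

/-- The defect of the pair `(Φ, ν)` as an orbital equivalence from `F` to `G`. -/
def defect (F : FormalField) (Φ : Fin 2 → Ser) (ν : Ser) (G : FormalField) : FormalField :=
  fun i => ∑ j, pderiv ℝ j (Φ i) * (ν * F j) - subst Φ (G i)

/-- `(Φ, ν)` conjugates `F` to `G` up to terms of degree at least `n + s`. -/
structure IsApprox (n : ℕ) (d : ℝ) (F : FormalField) (s : ℕ) (Φ : Fin 2 → Ser) (ν : Ser)
    (G : FormalField) : Prop where
  tangent : TangentToId n Φ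
  time : ν - 1 ∈ wtIdeal n 1
  leading : ∀ i, G i - (leadingField n d i : Ser) ∈ wtIdeal n (n + wt n i + 1)
  defect_mem : ∀ i, defect F Φ ν G i ∈ wtIdeal n (n + wt n i + s)

lemma isApprox_one {F : FormalField}
    (hF : ∀ i, F i - (leadingField n d i : Ser) ∈ wtIdeal n (n + wt n i + 1)) :
    IsApprox n d F 1 X 1 (toFormal (leadingField n d)) where
  tangent i := by rw [sub_self]; exact zero_mem _
  time := by rw [sub_self]; exact zero_mem _
  leading i := by rw [toFormal, sub_self]; exact zero_mem _
  defect_mem i := by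
    rw [defect, sum_pderiv_X_mul, one_mul, subst_self]
    exact hF i

lemma IsApprox.exists_succ {F : FormalField}
    (hF : ∀ i, F i - (leadingField n d i : Ser) ∈ wtIdeal n (n + wt n i + 1)) {s : ℕ} (hs : 1 ≤ s)
    (hd : d ^ 2 ≤ 1) {C' : Submodule ℝ Poly} (hC' : C' ≤ qhPoly n (s + n))
    (hC : ∀ q ∈ qhPoly n (s + n), ∃ p ∈ qhPoly n s, ∃ θ ∈ C',
      q = lieDeriv (leadingField n d) p + θ)
    {Φ : Fin 2 → Ser} {ν : Ser} {G : FormalField} (h : IsApprox n d F s Φ ν G) :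
    ∃ (Φ' : Fin 2 → Ser) (ν' : Ser) (θ : Poly), (∀ i, Φ' i - Φ i ∈ wtIdeal n (wt n i + s)) ∧
      ν' - ν ∈ wtIdeal n s ∧ θ ∈ C' ∧
      IsApprox n d F (s + 1) Φ' ν' (G + toFormal (θ • eulerField n)) := by
  choose V hV hV' using fun i => exists_qhPoly_sub_mem_wtIdeal (h.defect_mem i)
  have hVq : IsQHField n (s + n) V := fun i => by
    convert hV i using 2; ring
  obtain ⟨U, hU, α, hα, θ, hθ, hVU⟩ := exists_homological hd hC hVq
  -- The correction is `-U`, kept opaque so that only its defining equation is used.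
  obtain ⟨φ, hφU⟩ : ∃ φ : Fin 2 → Ser, ∀ i, φ i = -(U i : Ser) := ⟨_, fun _ => rfl⟩
  have hφ : ∀ i, φ i ∈ wtIdeal n (wt n i + s) := fun i => by
    rw [hφU, add_comm]; exact neg_mem (coe_mem_wtIdeal (hU i))
  have hα' : (α : Ser) ∈ wtIdeal n s := coe_mem_wtIdeal hα
  have hθD : ∀ i, ((θ * eulerField n i : Poly) : Ser) ∈ wtIdeal n (s + n + wt n i) := fun i =>
    coe_mem_wtIdeal (mul_mem_qhPoly (hC' hθ) (eulerField_mem_qhPoly i))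
  have hL : ∀ i, (leadingField n d i : Ser) ∈ wtIdeal n (n + wt n i) := fun i =>
    coe_mem_wtIdeal (leadingField_mem_qhPoly i)
  have hF' : ∀ i, F i ∈ wtIdeal n (n + wt n i) := fun i => by
    have := add_mem (wtIdeal_mono (Nat.le_succ _) (hF i)) (hL i)
    rwa [sub_add_cancel] at this
  have hΦ' : TangentToId n (Φ + φ) := h.tangent.add hs hφ
  have hν' : ν - α - 1 ∈ wtIdeal n 1 := by
    have := sub_mem h.time (wtIdeal_mono hs hα')
    rwa [sub_right_comm] at this
  refine ⟨Φ + φ, ν - α, θ, fun i => by simpa using hφ i, by simpa using hα', hθ, hΦ', hν', ?_, ?_⟩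
  · intro i
    have := add_mem (h.leading i) (wtIdeal_mono (by omega) (hθD i))
    rwa [sub_add_eq_add_sub] at this
  · intro i
    have hΦs := h.tangent.wtMap.hasSubst
    have hΦs' := hΦ'.wtMap.hasSubst
    have hVi : (V i : Ser) = α * leadingField n d i + ((θ * eulerField n i : Poly) : Ser)
        + ∑ j, ((leadingField n d j : Ser) * (MvPolynomial.pderiv j (U i) : Ser)
          - (U j : Ser) * (MvPolynomial.pderiv j (leadingField n d i) : Ser)) := by
      rw [hVU]
      simp only [Pi.add_apply, Pi.smul_apply, smul_eq_mul, lieBracket, lieDeriv_apply,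
        MvPolynomial.coe_add, coe_poly_sub, MvPolynomial.coe_mul, Fin.sum_univ_two]
      ring
    -- The first order effect of the three corrections is exactly `-V`; each remaining term has
    -- weight at least `n + wt n i + s + 1`.
    have key : defect F (Φ + φ) (ν - α) (G + toFormal (θ • eulerField n)) i
        = (defect F Φ ν G i - V i)
          + ∑ j, pderiv ℝ j (φ i) * ((ν - α - 1) * F j + (F j - leadingField n d j))
          - α * (F i - leadingField n d i)
          - ∑ j, pderiv ℝ j (Φ i - X i) * (α * F j)
          - taylorRemainder Φ φ (leadingField n d i)
          - (subst (Φ + φ) (G i - (leadingField n d i : Ser))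
            - subst Φ (G i - (leadingField n d i : Ser)))
          - (subst (Φ + φ) ((θ * eulerField n i : Poly) : Ser)
            - ((θ * eulerField n i : Poly) : Ser)) := by
      have hX := sum_pderiv_X_mul i (fun j => α * F j)
      rw [hVi]
      simp only [defect, toFormal, Pi.add_apply, Pi.smul_apply, smul_eq_mul, taylorRemainder,
        subst_add hΦs', subst_sub hΦs, subst_sub hΦs', Fin.sum_univ_two, map_add, map_sub, hφU,
        map_neg, pderiv_coe] at hX ⊢
      linear_combination (-1 : Ser) * hX
    rw [key]
    refine sub_mem (sub_mem (sub_mem (sub_mem (sub_mem (add_mem ?_ ?_) ?_) ?_) ?_) ?_) ?_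
    · exact hV' i
    · refine sum_mem fun j _ => ?_
      have hq : (ν - α - 1) * F j + (F j - leadingField n d j)
          ∈ wtIdeal n (n + 1 + wt n j) := by
        refine add_mem ?_ ?_
        · exact wtIdeal_mono (by omega) (mul_mem_wtIdeal hν' (hF' j))
        · exact wtIdeal_mono (by omega) (hF j)
      have := pderiv_mul_mem_wtIdeal j (hφ i) hq
      exact wtIdeal_mono (by omega) this
    · exact wtIdeal_mono (by omega) (mul_mem_wtIdeal hα' (hF i))
    · refine sum_mem fun j _ => ?_
      have hq : (α : Ser) * F j ∈ wtIdeal n (s + n + wt n j) := by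
        rw [add_assoc]; exact mul_mem_wtIdeal hα' (hF' j)
      have := pderiv_mul_mem_wtIdeal j (h.tangent i) hq
      exact wtIdeal_mono (by omega) this
    · exact taylorRemainder_mem h.tangent hs hφ (leadingField_mem_qhPoly i)
    · have := subst_sub_subst_mem_wtIdeal h.tangent.wtMap hΦ'.wtMap (s := s)
        (fun i => by simpa using hφ i) (h.leading i)
      exact wtIdeal_mono (by omega) this
    · exact wtIdeal_mono (by omega) (hΦ'.subst_sub_mem (hθD i))

/-- Continuity of the defect for the weight filtration, used to pass to the limit. -/
lemma defect_sub_defect_mem_wtIdeal {F : FormalField} (hF : ∀ i, F i ∈ wtIdeal n (wt n i))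
    {Φ Ψ : Fin 2 → Ser} {ν μ : Ser} {G H : FormalField} {s : ℕ} (hΦ : WtMap n Φ) (hΨ : WtMap n Ψ)
    (h : ∀ i, Ψ i - Φ i ∈ wtIdeal n (wt n i + s)) (hν : μ - ν ∈ wtIdeal n s)
    (hG : ∀ i, H i - G i ∈ wtIdeal n s) (i : Fin 2) :
    defect F Ψ μ H i - defect F Φ ν G i ∈ wtIdeal n s := by
  have e : defect F Ψ μ H i - defect F Φ ν G i
      = ∑ j, pderiv ℝ j (Ψ i - Φ i) * (μ * F j) + (∑ j, pderiv ℝ j (Φ i) * F j) * (μ - ν)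
        - (subst Ψ (H i) - subst Φ (H i)) - subst Φ (H i - G i) := by
    simp only [defect, subst_sub hΦ.hasSubst, Fin.sum_univ_two, map_sub]
    ring
  rw [e]
  refine sub_mem (sub_mem (add_mem (sum_mem fun j _ => ?_) (Ideal.mul_mem_left _ _ hν)) ?_)
    (hΦ.subst_mem (hG i))
  · exact wtIdeal_mono (by omega) (pderiv_mul_mem_wtIdeal (l := 0) j (h i)
      (by rw [zero_add]; exact Ideal.mul_mem_left _ _ (hF j)))
  · exact wtIdeal_mono (by omega) (subst_sub_subst_mem_wtIdeal hΦ hΨ h (mem_wtIdeal_zero (H i)))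

/-- The linear part is unipotent upper triangular: a term in `y` may occur in the first component,
having weight `n + 1`, but no term in `x` occurs in the second. -/
lemma TangentToId.isFormalDiffeo {Φ : Fin 2 → Ser} (hΦ : TangentToId n Φ) :
    IsFormalDiffeo Φ := by
  refine ⟨fun i => constantCoeff_eq_zero_of_mem_wtIdeal (k := 0)
    (wtIdeal_mono (one_le_wt n i) (hΦ.wtMap i)), ?_⟩
  have hc : ∀ (i j : Fin 2), wt n j ≤ wt n i → constantCoeff (pderiv ℝ j (Φ i))
      = constantCoeff (pderiv ℝ j (X i : Ser)) := by
    intro i j hij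
    rw [← sub_eq_zero, ← map_sub, ← map_sub]
    exact constantCoeff_eq_zero_of_mem_wtIdeal (k := 0)
      (pderiv_mem_wtIdeal (n := n) j (wtIdeal_mono (by omega) (hΦ i)))
  have h₀₀ := hc 0 0 le_rfl
  have h₁₁ := hc 1 1 le_rfl
  have h₁₀ := hc 1 0 (by simp [wt])
  rw [← MvPolynomial.coe_X, pderiv_coe] at h₀₀ h₁₁ h₁₀
  rw [Matrix.det_fin_two]
  simp only [Matrix.of_apply, h₀₀, h₁₁, h₁₀]
  simp [MvPolynomial.pderiv_X]

/-- The degree by degree construction of the normal form. -/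
theorem exists_formallyOrbitallyEquivalent {F : FormalField} (hd : d ^ 2 ≤ 1)
    (hF : ∀ i, F i - (leadingField n d i : Ser) ∈ wtIdeal n (n + wt n i + 1))
    {C' : ℕ → Submodule ℝ Poly} (hC' : ∀ s, C' s ≤ qhPoly n (s + n))
    (hC : ∀ s, 1 ≤ s → ∀ q ∈ qhPoly n (s + n), ∃ p ∈ qhPoly n s, ∃ θ ∈ C' s,
      q = lieDeriv (leadingField n d) p + θ) :
    ∃ θ : ℕ → Poly, (∀ t, θ t ∈ C' (t + 1)) ∧ ∃ G : FormalField,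
      (∀ t i, G i - ((leadingField n d + ∑ k ∈ Finset.range t, θ k • eulerField n) i : Poly)
        ∈ wtIdeal n (t + 1)) ∧ FormallyOrbitallyEquivalent F G := by
  -- The index is shifted by one: state `t` has its defect in degree `n + t + 1` and above, and the
  -- polynomial found from it has degree `n + t + 1`.
  let State (t : ℕ) := {x : (Fin 2 → Ser) × Ser × FormalField //
    IsApprox n d F (t + 1) x.1 x.2.1 x.2.2}
  have step : ∀ (t : ℕ) (x : State t), ∃ (y : State (t + 1)) (θ : Poly),
      (∀ i, y.1.1 i - x.1.1 i ∈ wtIdeal n (wt n i + (t + 1))) ∧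
      y.1.2.1 - x.1.2.1 ∈ wtIdeal n (t + 1) ∧ θ ∈ C' (t + 1) ∧
      y.1.2.2 = x.1.2.2 + toFormal (θ • eulerField n) := by
    rintro t ⟨⟨Φ, ν, G⟩, hx⟩
    obtain ⟨Φ', ν', θ, h₁, h₂, h₃, h₄⟩ :=
      hx.exists_succ hF (Nat.le_add_left 1 t) hd (hC' _) (hC _ (Nat.le_add_left 1 t))
    exact ⟨⟨⟨Φ', ν', _⟩, h₄⟩, θ, h₁, h₂, h₃, rfl⟩
  choose next ϑ hΦ hν hϑ hG using step
  let seq : ∀ t, State t :=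
    fun t => Nat.rec ⟨⟨X, 1, toFormal (leadingField n d)⟩, isApprox_one hF⟩ next t
  have hseq : ∀ t, seq (t + 1) = next t (seq t) := fun _ => rfl
  have hGt : ∀ t, (seq t).1.2.2 = toFormal (leadingField n d
      + ∑ k ∈ Finset.range t, ϑ k (seq k) • eulerField n) := by
    intro t
    induction t with
    | zero => simp [seq]
    | succ t ih =>
      rw [hseq, hG, ih, Finset.sum_range_succ, ← add_assoc]
      funext i
      simp [toFormal]
  have hΦlim : ∀ i, ∃ Ψ : Ser, ∀ t, Ψ - (seq t).1.1 i ∈ wtIdeal n (wt n i + 1 + t) := fun i =>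
    exists_limit fun t => wtIdeal_mono (by omega) (hΦ t (seq t) i)
  choose Ψ hΨ using hΦlim
  obtain ⟨μ, hμ⟩ : ∃ μ : Ser, ∀ t, μ - (seq t).1.2.1 ∈ wtIdeal n (1 + t) :=
    exists_limit fun t => wtIdeal_mono (by omega) (hν t (seq t))
  have hGlim : ∀ i, ∃ H : Ser, ∀ t, H - (seq t).1.2.2 i ∈ wtIdeal n (1 + t) := fun i =>
    exists_limit fun t => by
      rw [hseq, hG, Pi.add_apply, add_sub_cancel_left]
      exact wtIdeal_mono (by omega) (coe_mem_wtIdeal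
        (mul_mem_qhPoly (hC' _ (hϑ t (seq t))) (eulerField_mem_qhPoly i)))
  choose H hH using hGlim
  have hΨt : TangentToId n Ψ := fun i => by
    have := add_mem (hΨ i 0) ((seq 0).2.tangent i)
    rwa [sub_add_sub_cancel] at this
  have hF' : ∀ i, F i ∈ wtIdeal n (wt n i) := fun i => by
    have := add_mem (wtIdeal_mono (by omega) (hF i))
      (wtIdeal_mono (Nat.le_add_left _ n) (coe_mem_wtIdeal (leadingField_mem_qhPoly (d := d) i)))
    rwa [sub_add_cancel] at this
  refine ⟨fun t => ϑ t (seq t), fun t => hϑ t (seq t), H, fun t i => ?_, Ψ, μ,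
    hΨt.isFormalDiffeo, ?_, fun i => ?_⟩
  · have := hH i t
    rwa [hGt, add_comm 1] at this
  · have h := add_mem (wtIdeal_mono (by omega) (hμ 0)) (seq 0).2.time
    rw [sub_add_sub_cancel] at h
    have h' := constantCoeff_eq_zero_of_mem_wtIdeal (k := 0) h
    rw [map_sub, map_one, sub_eq_zero] at h'
    rw [h']; exact one_pos
  -- The limit differs from state `k` by terms of weight at least `k`, and so do the defects; hence
  -- the defect of the limit lies in every `wtIdeal n k`.
  · rw [← sub_eq_zero]
    refine eq_zero_of_forall_mem_wtIdeal (n := n) fun k => ?_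
    have h₁ := defect_sub_defect_mem_wtIdeal (s := k) hF' (seq k).2.tangent.wtMap hΨt.wtMap
      (fun i => wtIdeal_mono (by omega) (hΨ i k)) (wtIdeal_mono (by omega) (hμ k))
      (fun i => wtIdeal_mono (by omega) (hH i k)) i
    have h₂ := add_mem h₁ (wtIdeal_mono (by omega) ((seq k).2.defect_mem i))
    rwa [sub_add_cancel] at h₂

end Recursion

/-! ### Grouping the corrections by powers of the first integral -/

section Assembly

variable {n m₁ m₂ : ℕ}

lemma dissipation_sq_le_one (m₁ m₂ : ℕ) : dissipation m₁ m₂ ^ 2 ≤ 1 := by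
  rw [dissipation, div_pow]
  refine div_le_one_of_le₀ ?_ (by positivity)
  have : (0 : ℝ) ≤ m₁ * m₂ := by positivity
  nlinarith

lemma sub_leadingField_mem_wtIdeal {d : ℝ} {F : FormalField} {Fcomp : ℕ → PolyField}
    (hFcomp : ∀ j, n ≤ j → IsQHField n j (Fcomp j)) (hlead : Fcomp n = leadingField n d)
    (hF : HasSum (fun k : ℕ => toFormal (Fcomp (n + k))) F) (i : Fin 2) :
    F i - (leadingField n d i : Ser) ∈ wtIdeal n (n + wt n i + 1) := by
  intro e he
  have h := (MvPowerSeries.WithPiTopology.hasSum_iff_hasSum_coeff.1 (Pi.hasSum.1 hF i)) e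
  have h0 := hasSum_single (f := fun k => MvPowerSeries.coeff e (toFormal (Fcomp (n + k)) i)) 0
    fun k hk => coe_mem_wtIdeal (hFcomp (n + k) (Nat.le_add_right _ _) i) e (by omega)
  rw [map_sub, h.unique h0, add_zero, hlead, toFormal, sub_self]

lemma sum_range_mul_eq_sum_range_sum {A : Type*} [AddCommMonoid A] (f : ℕ → A) (N M : ℕ) :
    ∑ s ∈ Finset.range (N * M), f s
      = ∑ i ∈ Finset.range N, ∑ r ∈ Finset.range M, f (i * M + r) := by
  induction N with
  | zero => simp
  | succ N ih => rw [Nat.succ_mul, Finset.sum_range_add, ih, Finset.sum_range_succ]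

lemma sum_Icc_eq_sum_range {A : Type*} [AddCommMonoid A] (f : ℕ → A) {M : ℕ} (hM : 0 < M) :
    ∑ j ∈ Finset.Icc n (M + n - 1), f j = ∑ r ∈ Finset.range M, f (n + r) := by
  have e : Finset.Icc n (M + n - 1) = Finset.Ico n (M + n) := by
    ext j; simp only [Finset.mem_Icc, Finset.mem_Ico]; omega
  rw [e, Finset.sum_Ico_eq_sum_range, Nat.add_sub_cancel]

lemma coe_poly_sum {ι : Type*} (s : Finset ι) (f : ι → Poly) :
    ((∑ i ∈ s, f i : Poly) : Ser) = ∑ i ∈ s, (f i : Ser) :=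
  map_sum MvPolynomial.coeToMvPowerSeries.ringHom f s

end Assembly

end QHNormalForm

end

theorem mainTheorem6 (n m₁ m₂ : ℕ) (hn : 1 ≤ n) (hm₁ : 1 ≤ m₁) (hm₂ : 1 ≤ m₂)
    (hcop : Nat.Coprime m₁ m₂)
    (F : QHNormalForm.FormalField) (Fcomp : ℕ → QHNormalForm.PolyField)
    (hFcomp : ∀ j, n ≤ j → QHNormalForm.IsQHField n j (Fcomp j))
    (hlead : Fcomp n = QHNormalForm.leadingField n (QHNormalForm.dissipation m₁ m₂))
    (hF : HasSum (fun k : ℕ => QHNormalForm.toFormal (Fcomp (n + k))) F)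
    (Cor : ℕ → Submodule ℝ QHNormalForm.Poly)
    (hCor : ∀ j, n ≤ j → j ≤ QHNormalForm.integralDegree n m₁ m₂ + n - 1 →
      QHNormalForm.IsCorange n (QHNormalForm.dissipation m₁ m₂) j (Cor j)) :
    ∃ η : ℕ → ℕ → QHNormalForm.Poly,
      (∀ i j, n ≤ j → j ≤ QHNormalForm.integralDegree n m₁ m₂ + n - 1 → η i j ∈ Cor j) ∧
      ∃ R : QHNormalForm.FormalField,
        HasSum (fun i : ℕ => QHNormalForm.toFormal
          (∑ j ∈ Finset.Icc n (QHNormalForm.integralDegree n m₁ m₂ + n - 1),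
            (η (i + 1) j * QHNormalForm.firstIntegral n m₁ m₂ ^ (i + 1)) •
              QHNormalForm.eulerField n)) R ∧
        QHNormalForm.FormallyOrbitallyEquivalent F
          (QHNormalForm.toFormal
            (QHNormalForm.leadingField n (QHNormalForm.dissipation m₁ m₂)
              + ∑ j ∈ Finset.Icc (n + 1) (QHNormalForm.integralDegree n m₁ m₂ + n - 1),
                  η 0 j • QHNormalForm.eulerField n)
            + R) := by
  open QHNormalForm in
  set M := integralDegree n m₁ m₂ with hMdef
  set d := dissipation m₁ m₂ with hddef
  set I := firstIntegral n m₁ m₂ with hIdef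
  have hM : 0 < M := by
    rw [hMdef, integralDegree]; positivity
  have hmod : ∀ s, n + s % M ≤ M + n - 1 := fun s => by
    have := Nat.mod_lt s hM; omega
  have hdm : ∀ s, n + s % M + s / M * M = s + n := fun s => by
    have := Nat.mod_add_div' s M; omega
  obtain ⟨θ, hθ, G, hG, hFG⟩ := exists_formallyOrbitallyEquivalent
    -- Division of `s` by `M` writes the degree `n + s` as `j + i M` with `j = n + s % M` and `i = s
    -- / M`.
    (C' := fun s => (Cor (n + s % M)).map (LinearMap.mulRight ℝ (I ^ (s / M))))
    (dissipation_sq_le_one m₁ m₂) (sub_leadingField_mem_wtIdeal hFcomp hlead hF)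
    (by
      rintro s _ ⟨q, hq, rfl⟩
      have hq' : q ∈ qhPoly n (n + s % M) := by
        rw [← (hCor _ (Nat.le_add_right _ _) (hmod s)).2]
        exact Submodule.mem_sup_left hq
      have := mul_mem_qhPoly hq' (pow_mem_qhPoly (firstIntegral_mem_qhPoly (n := n) m₁ m₂) (s / M))
      rwa [← hMdef, hdm] at this)
    (by
      intro s _ q hq
      rw [← hdm s] at hq
      obtain ⟨p, hp, η, hη, h⟩ := exists_eq_lieDeriv_add_mul_pow hm₁ hm₂ hCor (s / M) _
        (Nat.le_add_right _ _) (hmod s) q hq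
      refine ⟨p, ?_, η * I ^ (s / M), ⟨η, hη, rfl⟩, h⟩
      rwa [← hMdef, Nat.add_sub_cancel_left, Nat.mod_add_div'] at hp)
  choose ζ hζ hζθ using hθ
  have hζθ' : ∀ t, θ t = ζ t * I ^ ((t + 1) / M) := fun t => (hζθ t).symm
  -- the coefficient of degree `n + s`
  let ξ : ℕ → Poly := fun s => Nat.casesOn s 0 ζ
  have hξ : ∀ s, ξ s ∈ Cor (n + s % M) := by
    rintro (_ | t)
    · exact zero_mem _
    · exact hζ t
  have hsum : ∀ t, ∑ s ∈ Finset.range (t + 1), (ξ s * I ^ (s / M)) • eulerField n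
      = ∑ k ∈ Finset.range t, θ k • eulerField n := by
    intro t
    rw [Finset.sum_range_succ']
    simp [ξ, hζθ']
  let η : ℕ → ℕ → Poly := fun i j => ξ (i * M + (j - n))
  have hblock : ∀ i, ∑ j ∈ Finset.Icc n (M + n - 1), (η i j * I ^ i) • eulerField n
      = ∑ r ∈ Finset.range M, (ξ (i * M + r) * I ^ ((i * M + r) / M)) • eulerField n := by
    intro i
    rw [sum_Icc_eq_sum_range _ hM]
    refine Finset.sum_congr rfl fun r hr => ?_
    have e : (i * M + r) / M = i := by
      rw [mul_comm, Nat.mul_add_div hM, Nat.div_eq_of_lt (Finset.mem_range.1 hr), add_zero]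
    rw [e]
    simp [η]
  -- The value `ξ 0 = 0` makes the term `j = n` vanish, so the first block can be completed to full
  -- length.
  have hfirst : ∑ j ∈ Finset.Icc (n + 1) (M + n - 1), η 0 j • eulerField n
      = ∑ j ∈ Finset.Icc n (M + n - 1), (η 0 j * I ^ 0) • eulerField n := by
    simp only [pow_zero, mul_one]
    refine Finset.sum_subset (Finset.Icc_subset_Icc_left (Nat.le_succ n)) fun j hj hj' => ?_
    have : j = n := by
      simp only [Finset.mem_Icc] at hj hj'; omega
    simp [η, ξ, this]
  -- The `N + 1` blocks of length `M` contain `(N + 1) * M - 1` corrections, because the slot of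
  -- degree `n` is empty.
  have hpartial : ∀ N, leadingField n d + ∑ j ∈ Finset.Icc (n + 1) (M + n - 1), η 0 j • eulerField n
      + ∑ i ∈ Finset.range N, ∑ j ∈ Finset.Icc n (M + n - 1),
        (η (i + 1) j * I ^ (i + 1)) • eulerField n
      = leadingField n d + ∑ k ∈ Finset.range ((N + 1) * M - 1), θ k • eulerField n := by
    intro N
    have hpos : 0 < (N + 1) * M := by positivity
    rw [← hsum, Nat.sub_add_cancel hpos, sum_range_mul_eq_sum_range_sum, Finset.sum_range_succ',
      hfirst, hblock 0, add_assoc, add_comm (∑ r ∈ Finset.range M, _)]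
    simp only [hblock]
  -- The tail `R` is what remains of `G` after the first block; `hpartial` turns the approximation
  -- of `G` by partial sums into convergence of the block series to `R`.
  refine ⟨η, fun i j h₁ h₂ => ?_, fun i => G i - toFormal (leadingField n d
    + ∑ j ∈ Finset.Icc (n + 1) (M + n - 1), η 0 j • eulerField n) i, ?_, ?_⟩
  · have h := hξ (i * M + (j - n))
    rw [mul_comm i M, Nat.mul_add_mod, Nat.mod_eq_of_lt (by omega), Nat.add_sub_cancel' h₁] at h
    simpa only [η, mul_comm i M] using h
  · rw [Pi.hasSum]
    intro i
    refine hasSum_of_forall_sub_mem_wtIdeal (n := n) fun N => ?_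
    have h := hG ((N + 1) * M - 1) i
    rw [← hpartial N] at h
    have hN : N ≤ (N + 1) * M - 1 + 1 := by
      have : N + 1 ≤ (N + 1) * M := Nat.le_mul_of_pos_right _ hM
      omega
    refine wtIdeal_mono hN ?_
    rw [Pi.add_apply _ (∑ i ∈ Finset.range N, _), MvPolynomial.coe_add, ← sub_sub,
      Finset.sum_apply, coe_poly_sum] at h
    exact h
  · convert hFG using 1
    funext i
    exact add_sub_cancel _ _
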